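/- All spaces are assumed to be completely regular and Hausdorff. A space is realcompact if it is homeomorphic to a closed subspace of a product of copies of $\mathbb{R}$. A space $X$ is locally realcompact if every $x\in X$ has an open neighborhood $U$ in $X$ such that $\mathrm{cl}_X U$ is realcompact. An extension of $X$ is a space $Y$ that contains $X$ as a dense subspace; its remainder is the subspace $Y\setminus X$. A compactification (realcompactification) of $X$ is a compact (realcompact) extension of $X$. Two extensions of $X$ are identified if there is a homeomorphism between them that fixes $X$ pointwise. Let $\mathscr{R}(X)$ denote the set of all realcompactifications of $X$ with compact remainder. Let $\beta X$ be the Stone–Čech compactification of $X$, and let $\upsilon X\subseteq\beta X$ be the Hewitt realcompactification of $X$, that is, the intersection of all cozero-sets of $\beta X$ that contain $X$. **Theorem.** Let $X$ be a locally realcompact space. 1. Let $\zeta X$ be a compactification of $X$, let $\phi:\beta X\to\zeta X$ be the continuous extension of $\mathrm{id}_X$, and let $E$ be a compact subspace of $\zeta X\setminus X$ with $\phi[\mathrm{cl}_{\beta X}(\upsilon X\setminus X)]\subseteq E$. Then $X\cup E$, considered as a subspace of $\zeta X$, belongs to $\mathscr{R}(X)$. 2. Conversely, every element of $\mathscr{R}(X)$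 is of this form: for each $Y\in\mathscr{R}(X)$ there are a compactification $\zeta X$ of $X$, with $\phi:\beta X\to\zeta X$ the continuous extension of $\mathrm{id}_X$, and a compact subspace $E$ of $\zeta X\setminus X$ containing $\phi[\mathrm{cl}_{\beta X}(\upsilon X\setminus X)]$, such that $Y$ is homeomorphic to the subspace $X\cup E$ of $\zeta X$ by a homeomorphism that fixes $X$ pointwise. -/

import Mathlib

open Set Filter Topology

universe u v

/-- A space is realcompact if it is homeomorphic to a closed subspace of a product of copies of
the real line. (The index type may be taken in the universe of the space, see
`IsRealcompact.of_isClosedEmbedding`.) Such a space is automatically completely regular and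
Hausdorff. -/
def IsRealcompact (Y : Type u) [TopologicalSpace Y] : Prop :=
  ∃ (ι : Type u) (f : Y → ι → ℝ), IsClosedEmbedding f

/-- The universe of the index type in `IsRealcompact` does not matter. -/
theorem IsRealcompact.of_isClosedEmbedding {Y : Type u} [TopologicalSpace Y] {κ : Type v}
    (f : Y → κ → ℝ) (hf : IsClosedEmbedding f) : IsRealcompact Y := by
  have hc : ∀ k, Continuous fun y => f y k := fun k => (continuous_apply k).comp hf.continuous
  have hg : Continuous (fun (y : Y) (g : C(Y, ℝ)) => g y) :=
    continuous_pi fun g => g.continuous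
  let r : (C(Y, ℝ) → ℝ) → κ → ℝ := fun t k => t ⟨fun y => f y k, hc k⟩
  have hr : Continuous r := continuous_pi fun k => continuous_apply _
  refine ⟨C(Y, ℝ), fun y g => g y, ?_⟩
  have hcomp : IsClosedEmbedding (r ∘ fun (y : Y) (g : C(Y, ℝ)) => g y) := hf
  refine IsClosedEmbedding.of_continuous_injective_isClosedMap hg hcomp.injective.of_comp ?_
  refine (isProperMap_of_comp_of_t2 hg hr hcomp.isProperMap).isClosedMap

/-- A space is locally realcompact if each point has an open neighbourhood with realcompact
closure. -/
def IsLocallyRealcompact (X : Type u) [TopologicalSpace X] : Prop :=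
  ∀ x : X, ∃ U : Set X, IsOpen U ∧ x ∈ U ∧ IsRealcompact (closure U)

/-- A cozero-set is the complement of the zero-set of a continuous map into `[0, 1]`. -/
def IsCozeroSet {Y : Type u} [TopologicalSpace Y] (C : Set Y) : Prop :=
  ∃ f : C(Y, unitInterval), C = {y | f y = 0}ᶜ

/-- The Hewitt realcompactification `υX` of `X`, as a subspace of the Stone–Čech compactification
`βX`: the intersection of all cozero-sets of `βX` which contain (the copy of) `X`. -/
def hewitt (X : Type u) [TopologicalSpace X] : Set (StoneCech X) :=
  ⋂₀ {C | IsCozeroSet C ∧ range (stoneCechUnit : X → StoneCech X) ⊆ C}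

theorem range_stoneCechUnit_subset_hewitt (X : Type u) [TopologicalSpace X] :
    range (stoneCechUnit : X → StoneCech X) ⊆ hewitt X :=
  subset_sInter fun _ hC => hC.2

/-- `υX` is realcompact. -/
theorem isRealcompact_hewitt (X : Type u) [TopologicalSpace X] :
    IsRealcompact (hewitt X) := by
  let I := {f : C(StoneCech X, unitInterval) //
    range (stoneCechUnit : X → StoneCech X) ⊆ {y | f y = 0}ᶜ}
  have hne : ∀ (p : StoneCech X), p ∈ hewitt X ↔ ∀ f : I, ((f.1 p : unitInterval) : ℝ) ≠ 0 := by
    intro p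
    constructor
    · intro hp f h0
      exact hp _ ⟨⟨f.1, rfl⟩, f.2⟩ (Subtype.ext h0)
    · rintro hp _ ⟨⟨f, rfl⟩, hf⟩ h0
      have h0 : f p = 0 := h0
      exact hp ⟨f, hf⟩ (by simp [h0])
  let F : hewitt X → (C(StoneCech X, ℝ) ⊕ I) → ℝ := fun p =>
    Sum.elim (fun g => g p.1) (fun f => ((f.1 p.1 : unitInterval) : ℝ)⁻¹)
  have hF : Continuous F := by
    refine continuous_pi ?_
    rintro (g | f)
    · exact g.continuous.comp continuous_subtype_val
    · exact Continuous.inv₀ (continuous_subtype_val.comp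
        (f.1.continuous.comp continuous_subtype_val)) fun p => (hne p.1).1 p.2 f
  refine ⟨_, F, IsClosedEmbedding.of_continuous_injective_isClosedMap hF ?_ ?_⟩
  · intro p q hpq
    by_contra hne'
    have hne'' : p.1 ≠ q.1 := fun h => hne' (Subtype.ext h)
    obtain ⟨g, hgp, hgq, -⟩ := exists_continuous_zero_one_of_isClosed
      (isClosed_singleton (x := p.1)) (isClosed_singleton (x := q.1))
      (by simpa using hne'')
    have h1 : g p.1 = g q.1 := congrFun hpq (Sum.inl g)
    rw [hgp rfl, hgq rfl] at h1
    simp at h1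
  · refine IsProperMap.isClosedMap (isProperMap_iff_ultrafilter.2 ⟨hF, fun 𝒰 y hy => ?_⟩)
    obtain ⟨p, -, hp⟩ := isCompact_univ.ultrafilter_le_nhds
      (𝒰.map (Subtype.val : hewitt X → StoneCech X)) (by simp)
    have hp : Tendsto (Subtype.val : hewitt X → StoneCech X) 𝒰 (𝓝 p) := hp
    have hpH : p ∈ hewitt X := by
      refine (hne p).2 fun f h0 => ?_
      have h1 : Tendsto (fun q : hewitt X => F q (Sum.inr f)) 𝒰 (𝓝 (y (Sum.inr f))) :=
        ((continuous_apply (Sum.inr f)).tendsto y).comp hy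
      have h2 : Tendsto (fun q : hewitt X => ((f.1 q.1 : unitInterval) : ℝ)) 𝒰
          (𝓝 ((f.1 p : unitInterval) : ℝ)) :=
        ((continuous_subtype_val.comp f.1.continuous).tendsto p).comp hp
      have h3 := h1.mul h2
      have h4 : (fun q : hewitt X => F q (Sum.inr f) * ((f.1 q.1 : unitInterval) : ℝ))
          = fun _ => 1 := by
        funext q
        exact inv_mul_cancel₀ ((hne q.1).1 q.2 f)
      rw [h4, h0, mul_zero] at h3
      exact one_ne_zero (tendsto_nhds_unique tendsto_const_nhds h3)
    have hlim : Tendsto id (𝒰 : Filter (hewitt X)) (𝓝 ⟨p, hpH⟩) :=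
      tendsto_subtype_rng.2 hp
    exact ⟨⟨p, hpH⟩, tendsto_nhds_unique ((hF.tendsto _).comp hlim) hy, hlim⟩

/-- Every continuous real-valued map on `X` extends continuously to `υX`. -/
theorem exists_extension_hewitt {X : Type u} [TopologicalSpace X] (f : C(X, ℝ)) :
    ∃ F : C(hewitt X, ℝ), ∀ x : X,
      F ⟨stoneCechUnit x, range_stoneCechUnit_subset_hewitt X ⟨x, rfl⟩⟩ = f x := by
  have hpos : ∀ x, 0 < 1 + |f x| := fun x => by positivity
  have hlt : ∀ x, |f x / (1 + |f x|)| < 1 := fun x => by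
    rw [abs_div, abs_of_pos (hpos x), div_lt_one (hpos x)]
    linarith
  let g : X → Icc (-1 : ℝ) 1 := fun x => ⟨f x / (1 + |f x|), abs_le.1 (hlt x).le⟩
  have hg : Continuous g := Continuous.subtype_mk
    (f.continuous.div (continuous_const.add f.continuous.abs) fun x => (hpos x).ne') _
  let G : StoneCech X → ℝ := fun p => (stoneCechExtend hg p).1
  have hG : Continuous G := continuous_subtype_val.comp (continuous_stoneCechExtend hg)
  have hGx : ∀ x, G (stoneCechUnit x) = f x / (1 + |f x|) := fun x => by
    simp [G, g, stoneCechExtend_stoneCechUnit]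
  have hG1 : ∀ p, |G p| ≤ 1 := fun p => abs_le.2 (stoneCechExtend hg p).2
  let h : C(StoneCech X, unitInterval) :=
    ⟨fun p => ⟨1 - |G p|, by linarith [hG1 p], by linarith [abs_nonneg (G p)]⟩,
      Continuous.subtype_mk (continuous_const.sub hG.abs) _⟩
  have hH : ∀ p : hewitt X, 1 - |G p.1| ≠ 0 := by
    intro p h0
    refine p.2 _ ⟨⟨h, rfl⟩, ?_⟩ (Subtype.ext h0)
    rintro _ ⟨x, rfl⟩ hx
    have hx : 1 - |G (stoneCechUnit x)| = 0 := congrArg Subtype.val hx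
    rw [hGx] at hx
    linarith [hlt x]
  refine ⟨⟨fun p => G p.1 / (1 - |G p.1|), ?_⟩, fun x => ?_⟩
  · exact (hG.comp continuous_subtype_val).div
      (continuous_const.sub (hG.comp continuous_subtype_val).abs) hH
  · show G (stoneCechUnit x) / (1 - |G (stoneCechUnit x)|) = f x
    rw [hGx, abs_div, abs_of_pos (hpos x)]
    have := (hpos x).ne'
    field_simp
    ring

/-- `e : X → K` exhibits `K` as a compactification of `X`: `K` is compact Hausdorff and `e` embeds
`X` as a dense subspace. -/
structure IsCompactification {X : Type u} {K : Type v} [TopologicalSpace X]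
    [TopologicalSpace K] (e : X → K) : Prop where
  compactSpace : CompactSpace K
  t2Space : T2Space K
  isDenseEmbedding : IsDenseEmbedding e

/-- `j : X → Y` exhibits `Y` as an element of `ℛ(X)`, i.e. a realcompactification of `X` with
compact remainder: `Y` is realcompact, `j` embeds `X` as a dense subspace, and `Y \ X` is
compact. -/
structure IsRealcompactificationWithCompactRemainder {X : Type u} {Y : Type v}
    [TopologicalSpace X] [TopologicalSpace Y] (j : X → Y) : Prop where
  isRealcompact : IsRealcompact Y
  isDenseEmbedding : IsDenseEmbedding j
  isCompact_remainder : IsCompact (range j)ᶜ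

/-- The data of the construction `X ∪ E`: `e : X → ζX` is a compactification of `X`,
`φ : βX → ζX` is the continuous extension of `id_X`, and `E` is a compact subspace of `ζX \ X`
which contains `φ[cl_{βX}(υX \ X)]`. -/
structure IsAdmissible {X : Type u} {K : Type v} [TopologicalSpace X] [TopologicalSpace K]
    (e : X → K) (φ : StoneCech X → K) (E : Set K) : Prop where
  isCompactification : IsCompactification e
  continuous : Continuous φ
  extends_id : ∀ x, φ (stoneCechUnit x) = e x
  isCompact : IsCompact E
  subset_remainder : E ⊆ (range e)ᶜ
  image_subset : φ '' closure (hewitt X \ range (stoneCechUnit : X → StoneCech X)) ⊆ E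

/-- The inclusion of `X` into the subspace `X ∪ E` of `ζX`. -/
def toUnion {X : Type u} {K : Type v} (e : X → K) (E : Set K) (x : X) :
    ↥(range e ∪ E) :=
  ⟨e x, Or.inl (mem_range_self x)⟩

/-! Both directions test realcompactness on ultrafilters. Let an ultrafilter on X ∪ E converge along
every continuous real-valued map. If it contains E, compactness gives a limit. Otherwise it lives on
X and converges to some p in βX, hence to φ p in ζX. If φ p were outside X ∪ E, then p would lie
outside υX, because φ sends υX \ X into E, and `exists_continuous_pole` would give a real-valued map
on X ∪ E tending to infinity along the ultrafilter, a contradiction.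

Conversely, given Y, take ζX = βY and E = Y \ X. An ultrafilter on X converging to p in υX \ X
converges in Y (`IsRealcompact.exists_tendsto_of_mem_hewitt`); its limit is φ p, which is not in X
because φ maps βX \ X off X (`mem_range_stoneCechUnit_of_mem_range`). -/

/-- A completely regular Hausdorff space in which every ultrafilter that converges along all
continuous real-valued maps converges is realcompact. -/
theorem isRealcompact_of_ultrafilter {Y : Type u} [TopologicalSpace Y] [T35Space Y]
    (h : ∀ 𝒰 : Ultrafilter Y, (∀ f : C(Y, ℝ), ∃ a, Tendsto f 𝒰 (𝓝 a)) →
      ∃ y, (𝒰 : Filter Y) ≤ 𝓝 y) : IsRealcompact Y := by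
  let F : Y → C(Y, ℝ) → ℝ := fun y f => f y
  have hF : Continuous F := continuous_pi fun f => f.continuous
  refine ⟨C(Y, ℝ), F, IsClosedEmbedding.of_continuous_injective_isClosedMap hF ?_
    (isProperMap_iff_ultrafilter.2 ⟨hF, fun 𝒰 t ht => ?_⟩).isClosedMap⟩
  · intro p q hpq
    by_contra hne
    obtain ⟨f, hf, hfp, hfq⟩ := CompletelyRegularSpace.completely_regular p {q}
      isClosed_singleton (by simpa using hne)
    have h1 : ((f p : unitInterval) : ℝ) = f q :=
      congrFun hpq ⟨fun y => (f y : ℝ), continuous_subtype_val.comp hf⟩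
    rw [hfp, hfq rfl] at h1
    simp at h1
  · obtain ⟨y, hy⟩ := h 𝒰 fun f => ⟨t f, ((continuous_apply f).tendsto t).comp ht⟩
    exact ⟨y, tendsto_nhds_unique ((hF.tendsto y).mono_left hy) ht, hy⟩

theorem IsRealcompact.t35Space {Y : Type u} [TopologicalSpace Y] (h : IsRealcompact Y) :
    T35Space Y := by
  obtain ⟨ι, f, hf⟩ := h
  exact hf.isEmbedding.t35Space

/-- In a dense extension, every point is a limit of an ultrafilter on the base space. -/
theorem DenseRange.exists_ultrafilter_tendsto {X : Type u} {Y : Type v} [TopologicalSpace Y]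
    {j : X → Y} (hj : DenseRange j) (y : Y) : ∃ 𝒰 : Ultrafilter X, Tendsto j 𝒰 (𝓝 y) := by
  have : (comap j (𝓝 y)).NeBot := comap_neBot fun s hs =>
    let ⟨x, hx⟩ := hj.mem_nhds hs
    ⟨x, hx⟩
  exact ⟨Ultrafilter.of _, tendsto_iff_comap.2 (Ultrafilter.of_le _)⟩

/-- A map `βX → K` that extends an embedding of `X` into `K` sends no point of `βX \ X` into the
copy of `X`. -/
theorem mem_range_stoneCechUnit_of_mem_range {X : Type u} {K : Type v} [TopologicalSpace X]
    [TopologicalSpace K] {e : X → K} (he : IsInducing e) {φ : StoneCech X → K}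
    (hφ : Continuous φ) (hφe : ∀ x, φ (stoneCechUnit x) = e x) {p : StoneCech X}
    (hp : φ p ∈ range e) : p ∈ range (stoneCechUnit : X → StoneCech X) := by
  obtain ⟨x, hx⟩ := hp
  obtain ⟨𝒰, h𝒰⟩ := denseRange_stoneCechUnit.exists_ultrafilter_tendsto p
  have h1 : Tendsto e 𝒰 (𝓝 (e x)) := by
    rw [hx, ← funext hφe]
    exact (hφ.tendsto p).comp h𝒰
  have h2 : (𝒰 : Filter X) ≤ 𝓝 x := by
    rw [he.nhds_eq_comap]
    exact tendsto_iff_comap.1 h1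
  exact ⟨x, tendsto_nhds_unique ((continuous_stoneCechUnit.tendsto x).mono_left h2) h𝒰⟩

/-- A continuous map of `X` into a realcompact space `Y` sends each ultrafilter on `X` which
converges in `υX` to a convergent one. -/
theorem IsRealcompact.exists_tendsto_of_mem_hewitt {X : Type u} {Y : Type v} [TopologicalSpace X]
    [TopologicalSpace Y] (hY : IsRealcompact Y) {j : X → Y} (hj : Continuous j)
    {p : StoneCech X} (hp : p ∈ hewitt X) {𝒰 : Ultrafilter X}
    (h𝒰 : Tendsto stoneCechUnit 𝒰 (𝓝 p)) : ∃ y, Tendsto j 𝒰 (𝓝 y) := by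
  obtain ⟨ι, F, hF⟩ := hY
  have h𝒰' : Tendsto (fun x : X => (⟨stoneCechUnit x,
      range_stoneCechUnit_subset_hewitt X ⟨x, rfl⟩⟩ : hewitt X)) 𝒰 (𝓝 ⟨p, hp⟩) :=
    tendsto_subtype_rng.2 h𝒰
  -- Each coordinate of `F ∘ j` extends continuously to υX, so it converges along `𝒰`; properness of
  -- `F` then lifts the limit to Y.
  have h1 : ∀ i, ∃ a, Tendsto (fun x => F (j x) i) 𝒰 (𝓝 a) := fun i => by
    obtain ⟨G, hG⟩ := exists_extension_hewitt
      (⟨fun x => F (j x) i, (continuous_apply i).comp (hF.continuous.comp hj)⟩ : C(X, ℝ))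
    exact ⟨G ⟨p, hp⟩, ((G.continuous.tendsto _).comp h𝒰').congr hG⟩
  choose a ha using h1
  obtain ⟨y, -, hy⟩ := (isProperMap_iff_ultrafilter.1 hF.isProperMap).2
    (𝒰 := 𝒰.map j) (y := a) (tendsto_pi_nhds.2 ha)
  exact ⟨y, hy⟩

/-- A point of `βX` outside `υX` whose image under an extension `φ : βX → K` of `e` misses the
compact set `E` is a pole of a continuous real-valued map on `X ∪ E`. -/
theorem exists_continuous_pole {X : Type u} {K : Type v} [TopologicalSpace X]
    [TopologicalSpace K] [CompactSpace K] [T2Space K] {e : X → K} (he : IsEmbedding e)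
    {φ : StoneCech X → K} (hφ : Continuous φ) (hφe : ∀ x, φ (stoneCechUnit x) = e x)
    {E : Set K} (hE : IsClosed E) (hEX : E ⊆ (range e)ᶜ) {p : StoneCech X}
    (hp : p ∉ hewitt X) (hpE : φ p ∉ E) :
    ∃ h : C(↥(range e ∪ E), ℝ), ∀ 𝒰 : Ultrafilter X, Tendsto stoneCechUnit 𝒰 (𝓝 p) →
      Tendsto (fun x => h (toUnion e E x)) 𝒰 atTop := by
  classical
  obtain ⟨f, hfX, hfp⟩ : ∃ f : C(StoneCech X, unitInterval),
      (∀ x, 0 < (f (stoneCechUnit x) : ℝ)) ∧ (f p : ℝ) = 0 := by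
    simp only [hewitt, mem_sInter, not_forall] at hp
    obtain ⟨_, ⟨⟨f, rfl⟩, hf⟩, hpf⟩ := hp
    refine ⟨f, fun x => ?_, congrArg Subtype.val (not_not.1 hpf : f p = 0)⟩
    exact lt_of_le_of_ne (f _).2.1 fun h0 => hf ⟨x, rfl⟩ (Subtype.ext h0.symm)
  obtain ⟨g, hg0, hg1, -⟩ := exists_continuous_zero_one_of_isClosed
    (isClosed_singleton (x := φ p)) hE (by simpa using hpE)
  have hg0 : g (φ p) = 0 := hg0 rfl
  -- A cutoff equal to 1 at `φ p` and to 0 wherever `g ≥ 1/2`, hence on a whole neighbourhood of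
  -- `E`. Thus `H / f` blows up at `p`, yet extends continuously by 0 over `E`.
  let H : K → ℝ := fun k => max 0 (1 - 2 * g k)
  have hH : Continuous H := by fun_prop
  let u : X → ℝ := fun x => H (e x) / f (stoneCechUnit x)
  have hu : Continuous u :=
    (hH.comp he.continuous).div
      (continuous_subtype_val.comp (f.continuous.comp continuous_stoneCechUnit))
      fun x => (hfX x).ne'
  let h : ↥(range e ∪ E) → ℝ := fun y => if hy : y.1 ∈ range e then u hy.choose else 0
  have hh : ∀ x, h (toUnion e E x) = u x := fun x => by
    have hx : (toUnion e E x).1 ∈ range e := ⟨x, rfl⟩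
    simp only [h, dif_pos hx]
    exact congrArg u (he.injective hx.choose_spec)
  -- As `E` is closed, X is open in X ∪ E, so continuity of `h` at points of X reduces to that of
  -- `u`.
  have hopen : IsOpenEmbedding (toUnion e E) := by
    refine ⟨IsEmbedding.of_comp (he.continuous.subtype_mk _) continuous_subtype_val he, ?_⟩
    have : range (toUnion e E) = Subtype.val ⁻¹' Eᶜ := by
      ext ⟨y, hy⟩
      constructor
      · rintro ⟨x, hx⟩ hyE
        exact hEX hyE ⟨x, congrArg Subtype.val hx⟩
      · intro hyE
        obtain ⟨x, hx⟩ := hy.resolve_right hyE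
        exact ⟨x, Subtype.ext hx⟩
    rw [this]
    exact hE.isOpen_compl.preimage continuous_subtype_val
  have hcont : Continuous h := continuous_iff_continuousAt.2 fun y => by
    by_cases hy : y.1 ∈ range e
    · obtain ⟨x, hx⟩ := hy
      obtain rfl : toUnion e E x = y := Subtype.ext hx
      rw [← hopen.continuousAt_iff, show h ∘ toUnion e E = u from funext hh]
      exact hu.continuousAt
    · have hyg : g y.1 = 1 := hg1 (y.2.resolve_left hy)
      have hev : ∀ᶠ z : ↥(range e ∪ E) in 𝓝 y, 1 / 2 < g z.1 :=
        (g.continuous.comp continuous_subtype_val).continuousAt.eventually_const_lt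
          (by rw [Function.comp_apply, hyg]; norm_num)
      refine (continuousAt_const (y := (0 : ℝ))).congr (hev.mono fun z hz => ?_)
      by_cases hze : z.1 ∈ range e
      · obtain ⟨x, hx⟩ := hze
        obtain rfl : toUnion e E x = z := Subtype.ext hx
        have hz : 1 / 2 < g (e x) := hz
        have hH0 : H (e x) = 0 := max_eq_left (by linarith)
        rw [hh]
        simp only [u, hH0, zero_div]
      · simp only [h, dif_neg hze]
  refine ⟨⟨h, hcont⟩, fun 𝒰 h𝒰 => ?_⟩
  have h1 : Tendsto (fun x => H (e x)) 𝒰 (𝓝 1) := by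
    have h2 := ((hH.comp hφ).tendsto p).comp h𝒰
    have h3 : (H ∘ φ) p = 1 := by simp [H, hg0]
    rw [h3] at h2
    exact h2.congr fun x => congrArg H (hφe x)
  -- The limit is one-sided because `f` is positive on X; this makes the reciprocal tend to +∞.
  have h4 : Tendsto (fun x => (f (stoneCechUnit x) : ℝ)) 𝒰 (𝓝[>] 0) := by
    refine tendsto_nhdsWithin_iff.2 ⟨?_, Eventually.of_forall hfX⟩
    rw [← hfp]
    exact ((continuous_subtype_val.comp f.continuous).tendsto p).comp h𝒰
  refine (h1.pos_mul_atTop one_pos h4.inv_tendsto_nhdsGT_zero).congr fun x => ?_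
  exact (hh x).symm

theorem IsAdmissible.isRealcompactificationWithCompactRemainder {X : Type u} {K : Type v}
    [TopologicalSpace X] [TopologicalSpace K] {e : X → K} {φ : StoneCech X → K} {E : Set K}
    (h : IsAdmissible e φ E) : IsRealcompactificationWithCompactRemainder (toUnion e E) := by
  have := h.isCompactification.compactSpace
  have := h.isCompactification.t2Space
  have hde := h.isCompactification.isDenseEmbedding
  have hind : IsInducing (Subtype.val : ↥(range e ∪ E) → K) := IsInducing.subtypeVal
  have hemb : IsEmbedding (toUnion e E) :=
    IsEmbedding.of_comp (hde.continuous.subtype_mk _) continuous_subtype_val hde.isEmbedding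
  refine ⟨isRealcompact_of_ultrafilter fun 𝒰 h𝒰 => ?_, ?_, ?_⟩
  · by_cases hX : range (toUnion e E) ∈ 𝒰
    · obtain ⟨𝒱, rfl⟩ : ∃ 𝒱 : Ultrafilter X, 𝒱.map (toUnion e E) = 𝒰 :=
        ⟨𝒰.comap hemb.injective hX, Ultrafilter.coe_injective (map_comap_of_mem hX)⟩
      obtain ⟨p, -, hp⟩ := isCompact_univ.ultrafilter_le_nhds
        (𝒱.map (stoneCechUnit : X → StoneCech X)) (by simp)
      have hp : Tendsto (stoneCechUnit : X → StoneCech X) 𝒱 (𝓝 p) := hp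
      have hφp : Tendsto e 𝒱 (𝓝 (φ p)) := by
        rw [← funext h.extends_id]
        exact (h.continuous.tendsto p).comp hp
      have hmem : φ p ∈ range e ∪ E := by
        by_contra hn
        obtain ⟨hne, hnE⟩ := not_or.1 hn
        have hpH : p ∉ hewitt X := fun hpH => hnE <| h.image_subset
          ⟨p, subset_closure ⟨hpH, fun ⟨x, hx⟩ => hne ⟨x, by rw [← hx, h.extends_id]⟩⟩, rfl⟩
        obtain ⟨g, hg⟩ := exists_continuous_pole hde.isEmbedding h.continuous h.extends_id
          h.isCompact.isClosed h.subset_remainder hpH hnE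
        obtain ⟨a, ha⟩ := h𝒰 g
        exact not_tendsto_nhds_of_tendsto_atTop (hg 𝒱 hp) a ha
      exact ⟨⟨φ p, hmem⟩, tendsto_subtype_rng.2 hφp⟩
    · have hE : Subtype.val ⁻¹' E ∈ 𝒰 := by
        filter_upwards [Ultrafilter.compl_mem_iff_notMem.2 hX] with y hy
        exact y.2.resolve_left fun ⟨x, hx⟩ => hy ⟨x, Subtype.ext hx⟩
      obtain ⟨k, hk, hlim⟩ := h.isCompact.ultrafilter_le_nhds
        (𝒰.map Subtype.val) (le_principal_iff.2 hE)
      exact ⟨⟨k, Or.inr hk⟩, tendsto_subtype_rng.2 hlim⟩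
  · refine ⟨⟨hemb.isInducing, fun y => ?_⟩, hemb.injective⟩
    rw [hind.closure_eq_preimage_closure_image, ← range_comp]
    exact hde.dense y.1
  · rw [hind.isCompact_iff]
    convert h.isCompact using 1
    ext k
    constructor
    · rintro ⟨y, hy, rfl⟩
      exact y.2.resolve_left fun ⟨x, hx⟩ => hy ⟨x, Subtype.ext hx⟩
    · exact fun hk => ⟨⟨k, Or.inr hk⟩,
        fun ⟨x, hx⟩ => h.subset_remainder hk ⟨x, congrArg Subtype.val hx⟩, rfl⟩

theorem IsRealcompactificationWithCompactRemainder.isAdmissible_stoneCech {X : Type u}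
    {Y : Type v} [TopologicalSpace X] [TopologicalSpace Y] {j : X → Y}
    (h : IsRealcompactificationWithCompactRemainder j)
    (hc : Continuous (stoneCechUnit ∘ j : X → StoneCech Y)) :
    IsAdmissible (stoneCechUnit ∘ j : X → StoneCech Y) (stoneCechExtend hc)
      (stoneCechUnit '' (range j)ᶜ) := by
  have := h.isRealcompact.t35Space
  have hY : IsDenseEmbedding (stoneCechUnit : Y → StoneCech Y) :=
    isDenseEmbedding_stoneCechUnit
  have he : IsDenseEmbedding (stoneCechUnit ∘ j : X → StoneCech Y) :=
    ⟨⟨hY.isInducing.comp h.isDenseEmbedding.isInducing,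
      hY.dense.comp h.isDenseEmbedding.dense hY.continuous⟩,
      hY.injective.comp h.isDenseEmbedding.injective⟩
  have hE : IsCompact ((stoneCechUnit : Y → StoneCech Y) '' (range j)ᶜ) :=
    h.isCompact_remainder.image continuous_stoneCechUnit
  refine ⟨⟨inferInstance, inferInstance, he⟩, continuous_stoneCechExtend hc,
    stoneCechExtend_stoneCechUnit hc, hE, ?_, ?_⟩
  · rintro _ ⟨y, hy, rfl⟩ ⟨x, hx⟩
    exact hy ⟨x, hY.injective hx⟩
  -- The remainder is compact, hence closed in βY, so it suffices to treat points of υX \ X itself.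
  · refine (image_closure_subset_closure_image (continuous_stoneCechExtend hc)).trans
      (closure_minimal ?_ hE.isClosed)
    rintro _ ⟨p, ⟨hpH, hpX⟩, rfl⟩
    obtain ⟨𝒰, h𝒰⟩ := denseRange_stoneCechUnit.exists_ultrafilter_tendsto p
    obtain ⟨y, hy⟩ := h.isRealcompact.exists_tendsto_of_mem_hewitt
      h.isDenseEmbedding.continuous hpH h𝒰
    have hφp : Tendsto (stoneCechUnit ∘ j : X → StoneCech Y) 𝒰 (𝓝 (stoneCechExtend hc p)) := by
      have h1 := ((continuous_stoneCechExtend hc).tendsto p).comp h𝒰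
      rwa [stoneCechExtend_extends hc] at h1
    have hyp : stoneCechUnit y = stoneCechExtend hc p :=
      tendsto_nhds_unique ((continuous_stoneCechUnit.tendsto y).comp hy) hφp
    refine ⟨y, fun ⟨x, hx⟩ => hpX ?_, hyp⟩
    exact mem_range_stoneCechUnit_of_mem_range he.isInducing (continuous_stoneCechExtend hc)
      (stoneCechExtend_stoneCechUnit hc) ⟨x, by rw [← hyp, ← hx]; rfl⟩

theorem mainTheorem9 (X : Type u) [TopologicalSpace X] [T35Space X]
    (hX : IsLocallyRealcompact X) :
    (∀ (K : Type v) [TopologicalSpace K] (e : X → K) (φ : StoneCech X → K) (E : Set K),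
      IsAdmissible e φ E → IsRealcompactificationWithCompactRemainder (toUnion e E)) ∧
    (∀ (Y : Type v) [TopologicalSpace Y] (j : X → Y),
      IsRealcompactificationWithCompactRemainder j →
        ∃ (K : Type v) (_ : TopologicalSpace K) (e : X → K) (φ : StoneCech X → K) (E : Set K),
          IsAdmissible e φ E ∧
            ∃ h : Y ≃ₜ ↥(range e ∪ E), ∀ x, h (j x) = toUnion e E x) := by
  refine ⟨fun K _ e φ E h => h.isRealcompactificationWithCompactRemainder, fun Y _ j h => ?_⟩
  have := h.isRealcompact.t35Space
  have hY : IsEmbedding (stoneCechUnit : Y → StoneCech Y) :=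
    isDenseEmbedding_stoneCechUnit.isEmbedding
  have hrange : range (stoneCechUnit : Y → StoneCech Y)
      = range (stoneCechUnit ∘ j : X → StoneCech Y) ∪ stoneCechUnit '' (range j)ᶜ := by
    rw [range_comp, ← image_union, union_compl_self, image_univ]
  exact ⟨StoneCech Y, inferInstance, stoneCechUnit ∘ j, _, _, h.isAdmissible_stoneCech
    (continuous_stoneCechUnit.comp h.isDenseEmbedding.continuous),
    hY.toHomeomorph.trans (Homeomorph.setCongr hrange), fun x => rfl⟩
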